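/- Let $n\ge 1$. Fix a smooth dyadic Littlewood–Paley partition of unity on $\mathbb{R}^n$: smooth functions $m_1$, supported in a ball, and $m$, supported in an annulus $a\le|\xi|\le b$ with $0<a$, such that $m_1(\xi)+\sum_{k\ge 1}m(2^{-k}\xi)=1$ for all $\xi$. For $\lambda=2^k$, $k\ge 1$, put $m_\lambda(\xi)=m(\xi/\lambda)$, and for a tempered distribution $f$ and dyadic $\lambda\ge 1$ let $P_\lambda f$ be the smooth function with $(P_\lambda f)^\wedge=m_\lambda\widehat f$. For $1\le p<\infty$, $B^{s,p}(\mathbb{R}^n)$ is the space of tempered distributions $f$ with $$\|f\|_{s,p}:=\Big(\sum_{\lambda=2^k,\ k\ge 0}\lambda^{sp}\|P_\lambda f\|_{L^p(\mathbb{R}^n)}^p\Big)^{1/p}<\infty .$$ Let $1\le q\le p<\infty$, $\frac1p<s<1+\frac1p$ and $0\le\alpha<s-\frac1p$. Let $\Gamma\subset\mathbb{R}^n$ be, up to a rigid motion, the graph $\{(u,\psi(u)):u\in A\}$ of a Lipschitz function $\psi:A\to\mathbb{R}$, $A\subset\mathbb{R}^{n-1}$, with surface measure $d\Gamma$ (the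 $(n-1)$-dimensional Hausdorff measure, normalized to agree with Lebesgue measure on $\mathbb R^{n-1}$), and suppose that $\Gamma$ is bounded or that $q=p$. Then there is a constant $C$, depending only on $n$, the partition of unity, $\Gamma,s,p,q,\alpha$, such that for every $f\in B^{s,p}(\mathbb{R}^n)$ the limit $$f(x):=\lim_{M\to\infty}\sum_{1\le\lambda\le M}P_\lambda f(x)$$ exists for Lebesgue-almost every $x\in\mathbb{R}^n$ and for $d\Gamma$-almost every $x\in\Gamma$, and, with this representative of $f$, $$\Big(\int_\Gamma\int_{|x-y|\le 1}\frac{|f(x)-f(y)|^q}{|x-y|^{n+\alpha q}}\,dx\,d\Gamma(y)\Big)^{1/q}\le C\,\|f\|_{s,p}.$$ -/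

import Mathlib

open MeasureTheory Filter Topology
open scoped SchwartzMap FourierTransform ENNReal NNReal ContDiff RealInnerProductSpace

noncomputable section

/-- A smooth dyadic Littlewood-Paley partition of unity on the frequency space `E`:
a smooth function `low` supported in a ball, a smooth function `annular` supported in an
annulus `a ≤ ‖ξ‖ ≤ b` with `0 < a`, and `low ξ + ∑_{k ≥ 1} annular (2⁻ᵏ ξ) = 1`. -/
structure LittlewoodPaley (E : Type*) [NormedAddCommGroup E] [NormedSpace ℝ E] where
  low : E → ℂ
  annular : E → ℂ
  low_smooth : ContDiff ℝ ∞ low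
  annular_smooth : ContDiff ℝ ∞ annular
  low_support : ∃ b : ℝ, ∀ ξ, low ξ ≠ 0 → ‖ξ‖ ≤ b
  annular_support : ∃ a b : ℝ, 0 < a ∧ ∀ ξ, annular ξ ≠ 0 → a ≤ ‖ξ‖ ∧ ‖ξ‖ ≤ b
  sum_eq_one : ∀ ξ, HasSum (fun k : ℕ => annular (((2 : ℝ) ^ (k + 1))⁻¹ • ξ)) (1 - low ξ)

namespace LittlewoodPaley

variable {E : Type*} [NormedAddCommGroup E] [InnerProductSpace ℝ E]

/-- The multiplier `m_λ` for `λ = 2 ^ k`: it is `low` for `λ = 1` and `annular (ξ / λ)`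
for `λ = 2, 4, 8, …`. -/
def symbol (m : LittlewoodPaley E) (k : ℕ) (ξ : E) : ℂ :=
  if k = 0 then m.low ξ else m.annular (((2 : ℝ) ^ k)⁻¹ • ξ)

theorem symbol_smooth (m : LittlewoodPaley E) (k : ℕ) : ContDiff ℝ ∞ (m.symbol k) := by
  by_cases hk : k = 0
  · have : m.symbol k = m.low := by funext ξ; simp [symbol, hk]
    rw [this]; exact m.low_smooth
  · have : m.symbol k = fun ξ => m.annular (((2 : ℝ) ^ k)⁻¹ • ξ) := by
      funext ξ; simp [symbol, hk]
    rw [this]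
    exact m.annular_smooth.comp (contDiff_const_smul _)

variable [FiniteDimensional ℝ E]

theorem symbol_hasCompactSupport (m : LittlewoodPaley E) (k : ℕ) :
    HasCompactSupport (m.symbol k) := by
  obtain ⟨b, hb⟩ := m.low_support
  obtain ⟨a, b', -, hb'⟩ := m.annular_support
  refine HasCompactSupport.of_support_subset_isCompact
    (isCompact_closedBall (0 : E) (max b (2 ^ k * b'))) fun ξ hξ => ?_
  rw [mem_closedBall_zero_iff]
  rw [Function.mem_support] at hξ
  by_cases hk : k = 0
  · exact le_max_of_le_left (hb ξ (by simpa [symbol, hk] using hξ))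
  · have h := (hb' (((2 : ℝ) ^ k)⁻¹ • ξ) (by simpa [symbol, hk] using hξ)).2
    rw [norm_smul, norm_inv, norm_pow, Real.norm_ofNat, inv_mul_le_iff₀ (by positivity)] at h
    exact le_max_of_le_right h

/-- The modulated multiplier `ξ ↦ m_λ(ξ) e^{2 π i ⟨ξ, y⟩}`, `λ = 2 ^ k`, a test function. -/
def wave (m : LittlewoodPaley E) (k : ℕ) (y : E) : 𝓢(E, ℂ) :=
  HasCompactSupport.toSchwartzMap
    (f := fun ξ : E => m.symbol k ξ * Complex.exp (((2 * Real.pi * ⟪ξ, y⟫ : ℝ) : ℂ) * Complex.I))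
    (m.symbol_hasCompactSupport k).mul_right
    ((m.symbol_smooth k).mul <| ContDiff.cexp <| (Complex.ofRealCLM.contDiff.comp
      (contDiff_const.mul (contDiff_id.inner ℝ contDiff_const))).mul contDiff_const)

variable [MeasurableSpace E] [BorelSpace E]

/-- The Littlewood-Paley piece `P_λ f`, `λ = 2 ^ k`, of a tempered distribution, as a tempered
distribution: the Fourier transform of `P_λ f` is `m_λ` times the Fourier transform of `f`. -/
def proj (m : LittlewoodPaley E) (k : ℕ) (f : 𝓢'(E, ℂ)) : 𝓢'(E, ℂ) :=
  TemperedDistribution.fourierMultiplierCLM ℂ (m.symbol k) f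

/-- The value at `y` of `P_λ f`, `λ = 2 ^ k`. Since `m_λ f̂` has compact support, `P_λ f` is a
smooth function, given by the Fourier inversion formula `P_λ f(y) = ⟨f̂, m_λ e^{2 π i ⟨·, y⟩}⟩`. -/
def projFun (m : LittlewoodPaley E) (k : ℕ) (f : 𝓢'(E, ℂ)) (y : E) : ℂ :=
  (𝓕 f) (m.wave k y)

/-- The partial sum `∑_{k < N} P_{2^k} f(y)` of the Littlewood-Paley decomposition. -/
def partialSum (m : LittlewoodPaley E) (N : ℕ) (f : 𝓢'(E, ℂ)) (y : E) : ℂ :=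
  ∑ k ∈ Finset.range N, m.projFun k f y

/-- The pointwise representative of `f`: the limit of the partial sums of its Littlewood-Paley
decomposition (an irrelevant constant where they diverge). -/
def representative (m : LittlewoodPaley E) (f : 𝓢'(E, ℂ)) (y : E) : ℂ :=
  limUnder atTop fun N => m.partialSum N f y

end LittlewoodPaley

variable {E : Type*} [NormedAddCommGroup E] [InnerProductSpace ℝ E] [FiniteDimensional ℝ E]
  [MeasurableSpace E] [BorelSpace E]

/-- The `L^p` norm of a tempered distribution: the `L^p` norm of the function `g ∈ L^p` which
it is, and `∞` if there is no such function. -/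
def distLpNorm (p : ℝ) (T : 𝓢'(E, ℂ)) : ℝ≥0∞ :=
  ⨅ (g : E → ℂ) (_ : MemLp g (ENNReal.ofReal p) volume)
    (_ : ∀ φ : 𝓢(E, ℂ), T φ = ∫ x, φ x * g x), eLpNorm g (ENNReal.ofReal p) volume

/-- The Besov norm `(∑_{λ ≥ 1} λ^{sp} ‖P_λ f‖_p^p)^{1/p}`, the sum over dyadic `λ = 2 ^ k`; the
space `B^{s,p}` consists of the tempered distributions where it is finite. -/
def besovNorm (m : LittlewoodPaley E) (s p : ℝ) (f : 𝓢'(E, ℂ)) : ℝ≥0∞ :=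
  (∑' k : ℕ, ENNReal.ofReal (((2 : ℝ) ^ k) ^ (s * p)) * distLpNorm p (m.proj k f) ^ p) ^ (1 / p)

/-- `Γ` is, up to a rigid motion, the graph `{(u, ψ u) : u ∈ A}` of a real-valued Lipschitz
function on a set `A ⊆ ℝ^d`. -/
def IsLipschitzGraph {d : ℕ} (Γ : Set (EuclideanSpace ℝ (Fin (d + 1)))) : Prop :=
  ∃ (T : EuclideanSpace ℝ (Fin (d + 1)) ≃ᵃⁱ[ℝ] EuclideanSpace ℝ (Fin (d + 1)))
    (A : Set (EuclideanSpace ℝ (Fin d))) (ψ : EuclideanSpace ℝ (Fin d) → ℝ) (K : ℝ≥0),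
    LipschitzOnWith K ψ A ∧
      Γ = (fun u => T (WithLp.toLp 2 (Fin.snoc (α := fun _ => ℝ) (fun i => u i) (ψ u)))) '' A

end

/-! Each piece reproduces itself: `P_λ f` is its own convolution with an `L¹`-normalized Schwartz
kernel at scale `1/λ`. Hence `|P_λ f|` is bounded by an average `smear` of itself, and for `0 ≤ β ≤
1` its increments from `y` to `z` are bounded by `(λ|y - z|)^β` times the averages at `y` and `z`.
Summing over `λ` with `V = smearSum β`, the series converges where `V < ∞`, and `|f(y) - f(z)| ≤ C
|y - z|^β (V(y) + V(z))` at two such points (`exists_smearSum_bound`).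

An `L¹`-normalized weight on `ℝ^(d+1)` has integral `O(λ)` over a Lipschitz graph, because one
dimension is lost. By Schur's test, restricting the averages to `Γ`, or to any translate of it,
costs `λ^(1/p)` in `L^p`. So `V` is in `L^p` of all translates, uniformly, once `β + 1/p < s`
(`exists_eLpNorm'_tsum_smear_le`); this uses only `sup_λ λ^s ‖P_λ f‖_p`.

Choose `α < β < s - 1/p` and write `x = y + h`. The double integral is then at most the integral
over `|h| ≤ 1` of `|h|^((β-α)q - n)`, which is finite, times the uniform bound for `V` on translates
(`lintegral_lintegral_translate_le`). Hölder's inequality passes from `L^p` to `L^q` on a parameter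
set of finite measure; for `q = p` nothing is needed. -/

noncomputable section

/-! ### Reproducing kernel of the Littlewood–Paley pieces -/

section Kernel

variable {E : Type*} [NormedAddCommGroup E] [InnerProductSpace ℝ E] [FiniteDimensional ℝ E]
  [MeasurableSpace E] [BorelSpace E]

namespace LittlewoodPaley

/-- A test function `χ` with `χ (2⁻ᵏ ξ) = 1` on the support of every `symbol k`. -/
theorem exists_cutoff (m : LittlewoodPaley E) :
    ∃ χ : 𝓢(E, ℂ), HasCompactSupport χ ∧
      ∀ k ξ, m.symbol k ξ * χ (((2 : ℝ) ^ k)⁻¹ • ξ) = m.symbol k ξ := by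
  obtain ⟨b, hb⟩ := m.low_support
  obtain ⟨a, b', -, hb'⟩ := m.annular_support
  let R : ℝ := max (max b b') 1
  let B : ContDiffBump (0 : E) := ⟨R, R + 1, by positivity, by linarith⟩
  have hc : HasCompactSupport (fun ξ => (B ξ : ℂ)) :=
    B.hasCompactSupport.comp_left (g := fun t : ℝ => (t : ℂ)) (by simp)
  have hs : ContDiff ℝ ∞ (fun ξ => (B ξ : ℂ)) :=
    Complex.ofRealCLM.contDiff.comp (f := fun ξ => B ξ) B.contDiff
  refine ⟨hc.toSchwartzMap hs, hc, fun k ξ => ?_⟩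
  rw [HasCompactSupport.toSchwartzMap_toFun]
  by_cases h0 : m.symbol k ξ = 0
  · simp [h0]
  rw [B.one_of_mem_closedBall, Complex.ofReal_one, mul_one]
  rw [mem_closedBall_zero_iff]
  by_cases hk : k = 0
  · subst hk
    simp only [pow_zero, inv_one, one_smul]
    exact (hb ξ (by simpa [symbol] using h0)).trans ((le_max_left _ _).trans (le_max_left _ _))
  · exact (hb' _ (by simpa [symbol, hk] using h0)).2.trans
      ((le_max_right _ _).trans (le_max_left _ _))

end LittlewoodPaley

/-- The test function `ξ ↦ χ (2⁻ᵏ ξ) e^{2 π i ⟨ξ, y⟩}`. -/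
def modulatedDilation {χ : 𝓢(E, ℂ)} (hχ : HasCompactSupport χ) (k : ℕ) (y : E) : 𝓢(E, ℂ) :=
  HasCompactSupport.toSchwartzMap
    (f := fun ξ : E => χ (((2 : ℝ) ^ k)⁻¹ • ξ) *
      Complex.exp (((2 * Real.pi * ⟪ξ, y⟫ : ℝ) : ℂ) * Complex.I))
    (hχ.comp_smul (c := ((2 : ℝ) ^ k)⁻¹) (by positivity)).mul_right
    (((χ.smooth ⊤).comp (contDiff_const_smul _)).mul <|
      ContDiff.cexp <| (Complex.ofRealCLM.contDiff.comp
      (contDiff_const.mul (contDiff_id.inner ℝ contDiff_const))).mul contDiff_const)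

theorem modulatedDilation_apply {χ : 𝓢(E, ℂ)} (hχ : HasCompactSupport χ) (k : ℕ) (y ξ : E) :
    modulatedDilation hχ k y ξ = χ (((2 : ℝ) ^ k)⁻¹ • ξ) *
      Complex.exp (((2 * Real.pi * ⟪ξ, y⟫ : ℝ) : ℂ) * Complex.I) :=
  HasCompactSupport.toSchwartzMap_toFun _ _ _

theorem fourier_modulatedDilation {χ : 𝓢(E, ℂ)} (hχ : HasCompactSupport χ) (k : ℕ) (y x : E) :
    𝓕 (modulatedDilation hχ k y) x =
      (((2 : ℝ) ^ k) ^ Module.finrank ℝ E) • 𝓕 χ ((2 : ℝ) ^ k • (x - y)) := by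
  rw [SchwartzMap.fourier_coe, SchwartzMap.fourier_coe, Real.fourier_eq', Real.fourier_eq']
  have h := Measure.integral_comp_inv_smul (volume : Measure E) (fun ξ : E =>
    Complex.exp (((-2 * Real.pi * ⟪ξ, (2 : ℝ) ^ k • (x - y)⟫ : ℝ) : ℂ) * Complex.I) • χ ξ)
    ((2 : ℝ) ^ k)
  rw [abs_of_nonneg (by positivity)] at h
  rw [← h]
  refine integral_congr_ae (ae_of_all _ fun ξ => ?_)
  simp only [modulatedDilation_apply, smul_eq_mul]
  rw [inner_smul_left, inner_smul_right, inner_sub_right]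
  simp only [conj_trivial]
  rw [mul_comm (χ _), ← mul_assoc, ← Complex.exp_add]
  congr 2
  rw [inv_mul_cancel_left₀ (by positivity)]
  push_cast
  ring

namespace LittlewoodPaley

/-- Since the cutoff is 1 on the support of the symbol, `wave` is the symbol times
`modulatedDilation`; the symbol is then moved onto `f`. -/
theorem projFun_eq_proj (m : LittlewoodPaley E) {χ : 𝓢(E, ℂ)} (hχ : HasCompactSupport χ)
    (hm : ∀ k ξ, m.symbol k ξ * χ (((2 : ℝ) ^ k)⁻¹ • ξ) = m.symbol k ξ)
    (k : ℕ) (f : 𝓢'(E, ℂ)) (y : E) :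
    m.projFun k f y = m.proj k f (𝓕 (modulatedDilation hχ k y)) := by
  rw [proj, TemperedDistribution.fourierMultiplierCLM_apply_apply, projFun,
    TemperedDistribution.fourier_apply, FourierTransform.fourierInv_fourier_eq]
  congr 2
  ext ξ
  rw [SchwartzMap.smulLeftCLM_apply_apply
    ((m.symbol_hasCompactSupport k).hasTemperateGrowth (m.symbol_smooth k)),
    modulatedDilation_apply, smul_eq_mul, ← mul_assoc, hm, wave,
    HasCompactSupport.toSchwartzMap_toFun]

/-- The kernel representation of the pieces: `P_λ f` is the convolution of the function
representing it with a dilated Schwartz kernel that does not depend on `λ`. -/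
theorem exists_kernel (m : LittlewoodPaley E) : ∃ K : 𝓢(E, ℂ), ∀ (k : ℕ) (f : 𝓢'(E, ℂ))
    (g : E → ℂ), (∀ φ : 𝓢(E, ℂ), m.proj k f φ = ∫ x, φ x * g x) → ∀ y,
      m.projFun k f y = ∫ x, ((((2 : ℝ) ^ k) ^ Module.finrank ℝ E) •
        K ((2 : ℝ) ^ k • (x - y))) * g x := by
  obtain ⟨χ, hχ, hm⟩ := m.exists_cutoff
  refine ⟨𝓕 χ, fun k f g hg y => ?_⟩
  rw [m.projFun_eq_proj hχ hm, hg]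
  simp only [fourier_modulatedDilation]

end LittlewoodPaley

end Kernel

/-! ### Decay and Hölder bounds for Schwartz kernels -/

section Pointwise

variable {E : Type*} [NormedAddCommGroup E] [InnerProductSpace ℝ E]

/-- The polynomially decaying weight `(1 + ‖z‖)⁻ʳ`. -/
def decayWeight (r : ℝ) (z : E) : ℝ≥0∞ := ENNReal.ofReal ((1 + ‖z‖) ^ (-r))

/-- The `L¹`-normalized dilation by `2⁻ᵏ` of the decay weight. -/
def dilatedWeight (r : ℝ) (k : ℕ) (z : E) : ℝ≥0∞ :=
  ENNReal.ofReal (((2 : ℝ) ^ k) ^ Module.finrank ℝ E) * decayWeight r ((2 : ℝ) ^ k • z)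

theorem SchwartzMap.exists_decay_bound (K : 𝓢(E, ℂ)) (N i : ℕ) :
    ∃ C : ℝ, 0 ≤ C ∧ ∀ z, ‖iteratedFDeriv ℝ i K z‖ ≤ C * (1 + ‖z‖) ^ (-(N : ℝ)) := by
  refine ⟨2 ^ N * ((Finset.Iic (N, i)).sup fun m => SchwartzMap.seminorm ℝ m.1 m.2) K,
    by positivity, fun z => ?_⟩
  have h := SchwartzMap.one_add_le_sup_seminorm_apply (𝕜 := ℝ) (m := (N, i)) le_rfl le_rfl K z
  rw [Real.rpow_neg (by positivity), Real.rpow_natCast, ← div_eq_mul_inv,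
    le_div_iff₀ (by positivity), mul_comm]
  exact h

theorem SchwartzMap.exists_holder_decay_bound (K : 𝓢(E, ℂ)) (N : ℕ) {β : ℝ} (hβ : 0 ≤ β)
    (hβ1 : β ≤ 1) : ∃ C : ℝ, 0 ≤ C ∧ ∀ z w, ‖K z - K w‖ ≤
      C * ‖z - w‖ ^ β * ((1 + ‖z‖) ^ (-(N : ℝ)) + (1 + ‖w‖) ^ (-(N : ℝ))) := by
  obtain ⟨C₀, hC₀, h₀⟩ := K.exists_decay_bound N 0
  obtain ⟨C₁, hC₁, h₁⟩ := K.exists_decay_bound N 1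
  simp only [norm_iteratedFDeriv_zero] at h₀
  simp only [norm_iteratedFDeriv_one] at h₁
  refine ⟨C₀ + C₁ * 2 ^ N, by positivity, fun z w => ?_⟩
  have pz : 0 ≤ (1 + ‖z‖) ^ (-(N : ℝ)) := by positivity
  have pw : 0 ≤ (1 + ‖w‖) ^ (-(N : ℝ)) := by positivity
  -- Far points: triangle inequality. Near points: mean value inequality, where `1 + ‖z‖ ≤ 2 (1 +
  -- ‖v‖)` for `v` within distance 1 of `z` produces the factor `2 ^ N`.
  rcases le_total 1 ‖z - w‖ with h | h
  · calc ‖K z - K w‖ ≤ ‖K z‖ + ‖K w‖ := norm_sub_le _ _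
      _ ≤ C₀ * 1 * ((1 + ‖z‖) ^ (-(N : ℝ)) + (1 + ‖w‖) ^ (-(N : ℝ))) := by
        linarith [h₀ z, h₀ w]
      _ ≤ _ := by
        gcongr
        · exact le_add_of_nonneg_right (by positivity)
        · exact Real.one_le_rpow h hβ
  · have hs : ∀ v ∈ Metric.closedBall z ‖z - w‖,
        ‖fderiv ℝ K v‖ ≤ C₁ * 2 ^ N * (1 + ‖z‖) ^ (-(N : ℝ)) := fun v hv => by
      refine (h₁ v).trans ?_
      rw [mul_assoc]
      gcongr
      have hzv : ‖z‖ ≤ ‖v‖ + 1 := by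
        have := norm_le_norm_add_norm_sub v z
        rw [mem_closedBall_iff_norm] at hv
        linarith
      rw [Real.rpow_neg (by positivity), Real.rpow_neg (by positivity), Real.rpow_natCast,
        Real.rpow_natCast, ← div_eq_mul_inv, le_div_iff₀ (by positivity),
        inv_mul_le_iff₀ (by positivity), ← mul_pow]
      gcongr
      linarith [norm_nonneg v]
    have := Convex.norm_image_sub_le_of_norm_fderiv_le (𝕜 := ℝ) (f := K) (x := w) (y := z)
      (fun v _ => K.differentiableAt) hs (convex_closedBall _ _)
      (by rw [mem_closedBall_iff_norm, norm_sub_rev]) (by simp)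
    calc ‖K z - K w‖ ≤ C₁ * 2 ^ N * (1 + ‖z‖) ^ (-(N : ℝ)) * ‖z - w‖ := this
      _ = C₁ * 2 ^ N * ‖z - w‖ * (1 + ‖z‖) ^ (-(N : ℝ)) := by ring
      _ ≤ _ := by
        gcongr
        · exact le_add_of_nonneg_left hC₀
        · exact Real.self_le_rpow_of_le_one (norm_nonneg _) h hβ1
        · exact le_add_of_nonneg_right pw

theorem measurable_decayWeight [MeasurableSpace E] [BorelSpace E] (r : ℝ) :
    Measurable (decayWeight (E := E) r) := by
  unfold decayWeight
  fun_prop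

theorem measurable_dilatedWeight [MeasurableSpace E] [BorelSpace E] (r : ℝ) (k : ℕ) :
    Measurable (dilatedWeight (E := E) r k) := by
  unfold dilatedWeight
  exact ((measurable_decayWeight r).comp (measurable_const_smul _)).const_mul _

end Pointwise

/-! ### Pointwise control of the pieces and their increments by averages -/

section Smear

variable {E : Type*} [NormedAddCommGroup E] [InnerProductSpace ℝ E] [FiniteDimensional ℝ E]
  [MeasurableSpace E] [BorelSpace E]

/-- The average of `‖g‖` against the dilated weight centred at `y`. -/
def smear (k : ℕ) (g : E → ℂ) (y : E) : ℝ≥0∞ :=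
  ∫⁻ x, dilatedWeight (Module.finrank ℝ E + 1) k (x - y) * ‖g x‖ₑ

theorem measurable_smear (k : ℕ) {g : E → ℂ} (hg : AEStronglyMeasurable g volume) :
    Measurable (smear k g) := by
  have : smear k g = smear k (hg.mk g) := by
    funext y
    refine lintegral_congr_ae ?_
    filter_upwards [hg.ae_eq_mk] with x hx
    rw [hx]
  rw [this]
  have h1 : Measurable fun z : E × E => dilatedWeight (Module.finrank ℝ E + 1) k (z.2 - z.1) :=
    (measurable_dilatedWeight _ _).comp (measurable_snd.sub measurable_fst)
  exact (h1.mul (hg.stronglyMeasurable_mk.measurable.comp measurable_snd).enorm).lintegral_prod_right'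

theorem enorm_dilation_le {c : ℂ} {k : ℕ} {A : ℝ≥0} {b : ℝ≥0∞} (h : ‖c‖ₑ ≤ A * b) :
    ‖(((2 : ℝ) ^ k) ^ Module.finrank ℝ E) • c‖ₑ ≤
      A * (ENNReal.ofReal (((2 : ℝ) ^ k) ^ Module.finrank ℝ E) * b) := by
  rw [enorm_smul, Real.enorm_of_nonneg (by positivity), mul_left_comm]
  gcongr

theorem exists_enorm_integral_kernel_le (K : 𝓢(E, ℂ)) : ∃ C : ℝ≥0, ∀ (k : ℕ) (g : E → ℂ) (y : E),
    ‖∫ x, ((((2 : ℝ) ^ k) ^ Module.finrank ℝ E) • K ((2 : ℝ) ^ k • (x - y))) * g x‖ₑ ≤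
      C * smear k g y := by
  obtain ⟨C, hC, h⟩ := K.exists_decay_bound (Module.finrank ℝ E + 1) 0
  simp only [norm_iteratedFDeriv_zero] at h
  refine ⟨C.toNNReal, fun k g y => (enorm_integral_le_lintegral_enorm _).trans ?_⟩
  rw [smear, ← lintegral_const_mul' _ _ ENNReal.coe_ne_top]
  refine lintegral_mono fun x => ?_
  rw [enorm_mul, ← mul_assoc]
  gcongr
  refine enorm_dilation_le ?_
  rw [decayWeight, ← ENNReal.ofReal, ← ENNReal.ofReal_mul hC, ← ofReal_norm]
  exact ENNReal.ofReal_le_ofReal (by simpa using h _)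

theorem SchwartzMap.memLp_comp_smul_sub (K : 𝓢(E, ℂ)) {c : ℝ} (hc : c ≠ 0) (y : E) (p : ℝ≥0∞) :
    MemLp (fun x => K (c • (x - y))) p volume := by
  have h : MemLp (fun x => K (c • x)) p volume := by
    have := (SchwartzMap.compCLMOfContinuousLinearEquiv ℂ
      (ContinuousLinearEquiv.smulLeft (R₁ := ℝ) (M₁ := E) (Units.mk0 c hc)) K).memLp p volume
    rw [SchwartzMap.compCLMOfContinuousLinearEquiv_apply] at this
    exact this
  exact h.comp_measurePreserving (measurePreserving_sub_right volume y)

/-- Hölder's inequality with the kernel in the dual exponent. Integrability is what lets a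
difference of convolutions be written as one integral. -/
theorem integrable_kernel_mul (K : 𝓢(E, ℂ)) {p : ℝ} (hp : 1 ≤ p) {g : E → ℂ}
    (hg : MemLp g (ENNReal.ofReal p) volume) (k : ℕ) (y : E) :
    Integrable (fun x => ((((2 : ℝ) ^ k) ^ Module.finrank ℝ E) •
      K ((2 : ℝ) ^ k • (x - y))) * g x) := by
  have hpc : (ENNReal.ofReal p).HolderConjugate (ENNReal.ofReal p).conjExponent :=
    ENNReal.HolderConjugate.conjExponent (by simpa using hp)
  have hpc' := hpc.symm
  have hK : MemLp (fun x => (((2 : ℝ) ^ k) ^ Module.finrank ℝ E) • K ((2 : ℝ) ^ k • (x - y)))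
      (ENNReal.ofReal p).conjExponent volume :=
    (K.memLp_comp_smul_sub (pow_ne_zero k two_ne_zero) y _).const_smul
      (((2 : ℝ) ^ k) ^ Module.finrank ℝ E)
  exact hK.integrable_mul hg

theorem exists_enorm_sub_integral_kernel_le (K : 𝓢(E, ℂ)) {β : ℝ} (hβ : 0 ≤ β) (hβ1 : β ≤ 1) :
    ∃ C : ℝ≥0, ∀ (k : ℕ) {p : ℝ}, 1 ≤ p → ∀ g : E → ℂ, MemLp g (ENNReal.ofReal p) volume →
    ∀ y z : E,
    ‖(∫ x, ((((2 : ℝ) ^ k) ^ Module.finrank ℝ E) • K ((2 : ℝ) ^ k • (x - y))) * g x) -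
      ∫ x, ((((2 : ℝ) ^ k) ^ Module.finrank ℝ E) • K ((2 : ℝ) ^ k • (x - z))) * g x‖ₑ ≤
      C * ENNReal.ofReal (((2 : ℝ) ^ k * ‖y - z‖) ^ β) * (smear k g y + smear k g z) := by
  obtain ⟨C, hC, h⟩ := K.exists_holder_decay_bound (Module.finrank ℝ E + 1) hβ hβ1
  refine ⟨C.toNNReal, fun k p hp g hg y z => ?_⟩
  rw [← integral_sub (integrable_kernel_mul K hp hg k y) (integrable_kernel_mul K hp hg k z)]
  refine (enorm_integral_le_lintegral_enorm _).trans ?_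
  have hm : AEMeasurable (fun x => ‖g x‖ₑ) volume := hg.1.enorm
  rw [smear, smear, ← lintegral_add_left', ← lintegral_const_mul']
  · refine lintegral_mono fun x => ?_
    simp only
    rw [← sub_mul, ← smul_sub, enorm_mul, ← add_mul, ← mul_assoc]
    gcongr
    have e : (2 : ℝ) ^ k * ‖y - z‖ = ‖(2 : ℝ) ^ k • (x - y) - (2 : ℝ) ^ k • (x - z)‖ := by
      rw [← smul_sub, sub_sub_sub_cancel_left, norm_smul, norm_sub_rev]
      simp
    have h' := h ((2 : ℝ) ^ k • (x - y)) ((2 : ℝ) ^ k • (x - z))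
    rw [← e] at h'
    rw [dilatedWeight, dilatedWeight, ← mul_add, mul_left_comm, enorm_smul,
      Real.enorm_of_nonneg (by positivity)]
    gcongr
    rw [decayWeight, decayWeight, ← ENNReal.ofReal, ← ENNReal.ofReal_mul hC,
      ← ENNReal.ofReal_add (by positivity) (by positivity),
      ← ENNReal.ofReal_mul (by positivity), ← ofReal_norm]
    exact ENNReal.ofReal_le_ofReal (by simpa using h')
  · exact ENNReal.mul_ne_top ENNReal.coe_ne_top ENNReal.ofReal_ne_top
  · exact (((measurable_dilatedWeight _ _).comp (measurable_id.sub_const _)).aemeasurable).mul hm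

end Smear

/-! ### Minkowski's inequality for countable sums -/

section Minkowski

variable {Ω : Type*} [MeasurableSpace Ω] {ν : Measure Ω}

/-- Monotone convergence reduces to finite sums: positive powers are order isomorphisms of `[0, ∞]`,
so they commute with suprema. -/
theorem eLpNorm'_tsum_le {u : ℕ → Ω → ℝ≥0∞} (hu : ∀ k, Measurable (u k)) {q : ℝ} (hq : 1 ≤ q) :
    eLpNorm' (fun a => ∑' k, u k a) q ν ≤ ∑' k, eLpNorm' (u k) q ν := by
  have hq0 : 0 < q := by linarith
  have hmeas : ∀ n, Measurable fun a => ∑ k ∈ Finset.range n, u k a := fun n =>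
    Finset.measurable_sum _ fun k _ => hu k
  have key : ∫⁻ a, (∑' k, u k a) ^ q ∂ν = ⨆ n, ∫⁻ a, (∑ k ∈ Finset.range n, u k a) ^ q ∂ν := by
    rw [← lintegral_iSup (fun n => (hmeas n).pow_const q)]
    · refine lintegral_congr fun a => ?_
      rw [ENNReal.tsum_eq_iSup_nat]
      exact (ENNReal.orderIsoRpow q hq0).map_iSup _
    · intro i j hij a
      exact ENNReal.rpow_le_rpow (Finset.sum_le_sum_of_subset (Finset.range_mono hij)) hq0.le
  have h1 : eLpNorm' (fun a => ∑' k, u k a) q ν =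
      ⨆ n, eLpNorm' (∑ k ∈ Finset.range n, u k) q ν := by
    simp only [eLpNorm', enorm_eq_self, Finset.sum_apply]
    rw [key]
    exact (ENNReal.orderIsoRpow (1 / q) (by positivity)).map_iSup _
  rw [h1]
  exact iSup_le fun n => (eLpNorm'_sum_le (fun k _ => (hu k).aestronglyMeasurable) hq).trans
    (ENNReal.sum_le_tsum _)

theorem eLpNorm'_const_mul_ennreal {u : Ω → ℝ≥0∞} (hu : Measurable u) (c : ℝ≥0∞) {q : ℝ}
    (hq : 0 < q) : eLpNorm' (fun a => c * u a) q ν = c * eLpNorm' u q ν := by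
  simp only [eLpNorm', enorm_eq_self]
  simp_rw [ENNReal.mul_rpow_of_nonneg _ _ hq.le]
  rw [lintegral_const_mul _ (hu.pow_const q), ENNReal.mul_rpow_of_nonneg _ _ (by positivity),
    ← ENNReal.rpow_mul, mul_one_div_cancel hq.ne', ENNReal.rpow_one]

theorem ae_lt_top_of_eLpNorm'_lt_top {u : Ω → ℝ≥0∞} (hu : Measurable u) {q : ℝ} (hq : 0 < q)
    (h : eLpNorm' u q ν < ⊤) : ∀ᵐ a ∂ν, u a < ⊤ := by
  have h2 : ∫⁻ a, u a ^ q ∂ν ≠ ⊤ := by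
    have := lintegral_rpow_enorm_eq_rpow_eLpNorm' (μ := ν) (f := u) hq
    simp only [enorm_eq_self] at this
    rw [this]
    exact ENNReal.rpow_ne_top_of_nonneg hq.le h.ne
  filter_upwards [ae_lt_top (hu.pow_const q) h2] with a ha
  exact (ENNReal.rpow_lt_top_iff_of_pos hq).1 ha

end Minkowski

/-! ### Schur's test for the averages -/

section Weight

variable {E : Type*} [NormedAddCommGroup E] [InnerProductSpace ℝ E] [FiniteDimensional ℝ E]
  [MeasurableSpace E] [BorelSpace E]

theorem lintegral_dilatedWeight (r : ℝ) (k : ℕ) :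
    ∫⁻ z : E, dilatedWeight r k z = ∫⁻ z : E, decayWeight r z := by
  have h2 : (0 : ℝ) < 2 ^ k := by positivity
  have h := lintegral_map (μ := (volume : Measure E)) (measurable_decayWeight (E := E) r)
    (measurable_const_smul ((2 : ℝ) ^ k))
  rw [Measure.map_addHaar_smul _ h2.ne', lintegral_smul_measure, abs_of_pos (by positivity)] at h
  unfold dilatedWeight
  have hm : Measurable fun z : E => decayWeight r ((2 : ℝ) ^ k • z) :=
    (measurable_decayWeight r).comp (measurable_const_smul _)
  rw [lintegral_const_mul _ hm, ← h,
    smul_eq_mul, ← mul_assoc, ← ENNReal.ofReal_mul (by positivity),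
    mul_inv_cancel₀ (by positivity), ENNReal.ofReal_one, one_mul]

theorem lintegral_dilatedWeight_sub (r : ℝ) (k : ℕ) (y : E) :
    ∫⁻ x : E, dilatedWeight r k (x - y) = ∫⁻ z : E, decayWeight r z := by
  rw [lintegral_sub_right_eq_self, lintegral_dilatedWeight]

theorem lintegral_dilatedWeight_sub_left (r : ℝ) (k : ℕ) (x : E) :
    ∫⁻ y : E, dilatedWeight r k (x - y) = ∫⁻ z : E, decayWeight r z := by
  rw [lintegral_sub_left_eq_self, lintegral_dilatedWeight]

theorem lintegral_decayWeight_lt_top {r : ℝ} (hr : Module.finrank ℝ E < r) :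
    ∫⁻ z : E, decayWeight r z < ⊤ :=
  finite_integral_one_add_norm hr

variable {Ω : Type*} [MeasurableSpace Ω] {ν : Measure Ω} [SFinite ν]

/-- Jensen's inequality for the weight viewed as a measure, whose mass depends on neither `k` nor
`y`. -/
theorem smear_rpow_le (k : ℕ) {g : E → ℂ} (hg : Measurable g) {p : ℝ} (hp : 1 ≤ p) (y : E) :
    smear k g y ^ p ≤ (∫⁻ z : E, decayWeight (Module.finrank ℝ E + 1) z) ^ (p - 1) *
      ∫⁻ x, dilatedWeight (Module.finrank ℝ E + 1) k (x - y) * ‖g x‖ₑ ^ p := by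
  have hp0 : 0 < p := by linarith
  set w : E → ℝ≥0∞ := fun x => dilatedWeight (Module.finrank ℝ E + 1) k (x - y) with hw
  have hwm : Measurable w := (measurable_dilatedWeight _ _).comp (measurable_id.sub_const _)
  have h := eLpNorm'_le_eLpNorm'_mul_rpow_measure_univ (μ := volume.withDensity w) (f := g)
    one_pos hp hg.aestronglyMeasurable
  have hu : (volume.withDensity w) Set.univ =
      ∫⁻ z : E, decayWeight (Module.finrank ℝ E + 1) z := by
    rw [withDensity_apply _ MeasurableSet.univ, Measure.restrict_univ, hw,
      lintegral_dilatedWeight_sub]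
  rw [hu] at h
  simp only [eLpNorm', ENNReal.rpow_one, div_one] at h
  rw [mul_comm, lintegral_withDensity_eq_lintegral_mul _ hwm hg.enorm,
    lintegral_withDensity_eq_lintegral_mul _ hwm (hg.enorm.pow_const p)] at h
  have h' := ENNReal.rpow_le_rpow h hp0.le
  rw [ENNReal.mul_rpow_of_nonneg _ _ hp0.le, ← ENNReal.rpow_mul, ← ENNReal.rpow_mul,
    one_div_mul_cancel hp0.ne', ENNReal.rpow_one,
    show (1 - 1 / p) * p = p - 1 by field_simp] at h'
  exact h'

/-- Jensen in `x`, then Tonelli and the bound `A` in `a`. Leaving `Y` general covers the whole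
space, the graph and its translates at once. -/
theorem eLpNorm'_smear_le (k : ℕ) {g : E → ℂ} (hg : AEStronglyMeasurable g volume) {p : ℝ}
    (hp : 1 ≤ p) {Y : Ω → E} (hY : Measurable Y) {A : ℝ≥0∞}
    (hA : ∀ x, ∫⁻ a, dilatedWeight (Module.finrank ℝ E + 1) k (x - Y a) ∂ν ≤ A) :
    eLpNorm' (fun a => smear k g (Y a)) p ν ≤
      (∫⁻ z : E, decayWeight (Module.finrank ℝ E + 1) z) ^ (1 - 1 / p) * A ^ (1 / p) *
        eLpNorm' g p volume := by
  have hp0 : 0 < p := by linarith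
  wlog hgm : Measurable g generalizing g
  · have h := this hg.stronglyMeasurable_mk.measurable.aestronglyMeasurable
      hg.stronglyMeasurable_mk.measurable
    have e : smear k g = smear k (hg.mk g) := by
      funext y
      refine lintegral_congr_ae ?_
      filter_upwards [hg.ae_eq_mk] with x hx
      rw [hx]
    rw [← e, ← eLpNorm'_congr_ae hg.ae_eq_mk] at h
    exact h
  set B := ∫⁻ z : E, decayWeight (Module.finrank ℝ E + 1) z with hB
  set W := fun (a : Ω) (x : E) => dilatedWeight (Module.finrank ℝ E + 1) k (x - Y a) with hW
  have hWm : Measurable (Function.uncurry W) :=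
    (measurable_dilatedWeight _ _).comp (measurable_snd.sub (hY.comp measurable_fst))
  have h1 : ∫⁻ a, smear k g (Y a) ^ p ∂ν ≤ B ^ (p - 1) * (A * ∫⁻ x, ‖g x‖ₑ ^ p) := by
    calc ∫⁻ a, smear k g (Y a) ^ p ∂ν
        ≤ ∫⁻ a, B ^ (p - 1) * (∫⁻ x, W a x * ‖g x‖ₑ ^ p) ∂ν :=
          lintegral_mono fun a => smear_rpow_le k hgm hp (Y a)
      _ = B ^ (p - 1) * ∫⁻ a, (∫⁻ x, W a x * ‖g x‖ₑ ^ p) ∂ν := by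
          rw [lintegral_const_mul]
          exact (hWm.mul ((hgm.enorm.pow_const p).comp measurable_snd)).lintegral_prod_right'
      _ = B ^ (p - 1) * ∫⁻ x, ∫⁻ a, W a x * ‖g x‖ₑ ^ p ∂ν := by
          rw [lintegral_lintegral_swap]
          exact (hWm.mul ((hgm.enorm.pow_const p).comp measurable_snd)).aemeasurable
      _ ≤ B ^ (p - 1) * ∫⁻ x, A * ‖g x‖ₑ ^ p := by
          gcongr with x
          rw [lintegral_mul_const _ hWm.of_uncurry_right]
          gcongr
          exact hA x
      _ = _ := by rw [lintegral_const_mul _ (hgm.enorm.pow_const p)]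
  have h2 := ENNReal.rpow_le_rpow h1 (show 0 ≤ 1 / p by positivity)
  rw [ENNReal.mul_rpow_of_nonneg _ _ (by positivity), ENNReal.mul_rpow_of_nonneg _ _ (by positivity),
    ← ENNReal.rpow_mul, show (p - 1) * (1 / p) = 1 - 1 / p by field_simp, ← mul_assoc] at h2
  simpa only [eLpNorm', enorm_eq_self] using h2

theorem ofReal_two_pow_rpow (k : ℕ) (t : ℝ) :
    ENNReal.ofReal (((2 : ℝ) ^ k) ^ t) = ENNReal.ofReal ((2 : ℝ) ^ t) ^ k := by
  rw [← ENNReal.ofReal_pow (by positivity), ← Real.rpow_natCast, ← Real.rpow_natCast,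
    ← Real.rpow_mul (by positivity), ← Real.rpow_mul (by positivity), mul_comm]

theorem tsum_ofReal_two_pow_rpow_lt_top {t : ℝ} (ht : t < 0) :
    ∑' k : ℕ, ENNReal.ofReal (((2 : ℝ) ^ k) ^ t) < ⊤ := by
  simp_rw [ofReal_two_pow_rpow]
  rw [ENNReal.tsum_geometric, ENNReal.inv_lt_top, tsub_pos_iff_lt, ENNReal.ofReal_lt_one]
  exact Real.rpow_lt_one_of_one_lt_of_neg one_lt_two ht

variable (E) in
/-- The summed trace estimate: a weighted sum of averages of functions whose norms decay like
`2⁻ᵏˢ`, restricted along `Y`, is controlled in `L^p`. -/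
theorem exists_eLpNorm'_tsum_smear_le {s p β : ℝ} (hp : 1 ≤ p) (hβ : β + 1 / p < s) {A : ℝ≥0∞}
    (hA : A < ⊤) : ∃ C : ℝ≥0, ∀ Y : Ω → E, Measurable Y →
      (∀ k x, ∫⁻ a, dilatedWeight (Module.finrank ℝ E + 1) k (x - Y a) ∂ν ≤
        A * ENNReal.ofReal ((2 : ℝ) ^ k)) →
      ∀ (g : ℕ → E → ℂ) (S : ℝ≥0∞), (∀ k, AEStronglyMeasurable (g k) volume) →
        (∀ k, ENNReal.ofReal (((2 : ℝ) ^ k) ^ s) * eLpNorm' (g k) p volume ≤ S) →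
      eLpNorm' (fun a => ∑' k, ENNReal.ofReal (((2 : ℝ) ^ k) ^ β) * smear k (g k) (Y a)) p ν ≤
        C * S := by
  have hp0 : 0 < p := by linarith
  set B := ∫⁻ z : E, decayWeight (Module.finrank ℝ E + 1) z with hB
  have hBt : B < ⊤ := lintegral_decayWeight_lt_top (by simp)
  set C₀ := B ^ (1 - 1 / p) * A ^ (1 / p) with hC₀
  have h1p : 0 ≤ 1 - 1 / p := by
    rw [sub_nonneg, div_le_one hp0]
    exact hp
  have hC₀t : C₀ < ⊤ := ENNReal.mul_lt_top (ENNReal.rpow_lt_top_of_nonneg h1p hBt.ne)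
    (ENNReal.rpow_lt_top_of_nonneg (by positivity) hA.ne)
  -- The exponent collects the weight `β`, the restriction loss `1/p` and the decay `-s`; it is
  -- negative, so the series is geometric.
  set G := ∑' k : ℕ, ENNReal.ofReal (((2 : ℝ) ^ k) ^ (β + 1 / p - s)) with hG
  have hGt : G < ⊤ := tsum_ofReal_two_pow_rpow_lt_top (by linarith)
  refine ⟨(G * C₀).toNNReal, fun Y hY hYA g S hg hS => ?_⟩
  rw [ENNReal.coe_toNNReal (ENNReal.mul_lt_top hGt hC₀t).ne]
  have hm : ∀ k, Measurable fun a => smear k (g k) (Y a) := fun k =>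
    (measurable_smear k (hg k)).comp hY
  refine (eLpNorm'_tsum_le (fun k => (hm k).const_mul _) hp).trans ?_
  rw [mul_assoc, hG, ← ENNReal.tsum_mul_right]
  refine ENNReal.tsum_le_tsum fun k => ?_
  rw [eLpNorm'_const_mul_ennreal (hm k) _ hp0]
  have hk : (0 : ℝ) < 2 ^ k := by positivity
  calc ENNReal.ofReal (((2 : ℝ) ^ k) ^ β) * eLpNorm' (fun a => smear k (g k) (Y a)) p ν
      ≤ ENNReal.ofReal (((2 : ℝ) ^ k) ^ β) * (B ^ (1 - 1 / p) *
        (A * ENNReal.ofReal ((2 : ℝ) ^ k)) ^ (1 / p) * eLpNorm' (g k) p volume) := by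
        gcongr
        exact eLpNorm'_smear_le k (hg k) hp hY (hYA k)
    _ = ENNReal.ofReal (((2 : ℝ) ^ k) ^ (β + 1 / p - s)) * (C₀ *
        (ENNReal.ofReal (((2 : ℝ) ^ k) ^ s) * eLpNorm' (g k) p volume)) := by
        rw [ENNReal.mul_rpow_of_nonneg _ _ (by positivity),
          ENNReal.ofReal_rpow_of_pos hk, hC₀]
        have : ENNReal.ofReal (((2 : ℝ) ^ k) ^ β) * ENNReal.ofReal (((2 : ℝ) ^ k) ^ (1 / p)) =
            ENNReal.ofReal (((2 : ℝ) ^ k) ^ (β + 1 / p - s)) *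
              ENNReal.ofReal (((2 : ℝ) ^ k) ^ s) := by
          rw [← ENNReal.ofReal_mul (by positivity), ← ENNReal.ofReal_mul (by positivity),
            ← Real.rpow_add hk, ← Real.rpow_add hk, sub_add_cancel]
        have comm : ∀ a b c e n : ℝ≥0∞, a * (b * (c * e) * n) = a * e * (b * c * n) := by
          intros; ring
        rw [comm, this]
        ring
    _ ≤ _ := by
        gcongr
        exact hS k

end Weight

/-! ### Lipschitz graphs and the loss of one dimension -/

section Graph

variable {d : ℕ}

/-- The point `(u, t)` of `ℝ^{d+1}`. -/
def EuclideanSpace.snoc (u : EuclideanSpace ℝ (Fin d)) (t : ℝ) : EuclideanSpace ℝ (Fin (d + 1)) :=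
  WithLp.toLp 2 (Fin.snoc (α := fun _ => ℝ) (fun i => u i) t)

/-- The first `d` coordinates of a point of `ℝ^{d+1}`. -/
def EuclideanSpace.init (v : EuclideanSpace ℝ (Fin (d + 1))) : EuclideanSpace ℝ (Fin d) :=
  WithLp.toLp 2 (fun i => v i.castSucc)

theorem EuclideanSpace.norm_init_le (v : EuclideanSpace ℝ (Fin (d + 1))) :
    ‖EuclideanSpace.init v‖ ≤ ‖v‖ := by
  rw [EuclideanSpace.norm_eq, EuclideanSpace.norm_eq, Fin.sum_univ_castSucc]
  exact Real.sqrt_le_sqrt (le_add_of_nonneg_right (by positivity))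

theorem EuclideanSpace.norm_le_norm_init_add (v : EuclideanSpace ℝ (Fin (d + 1))) :
    ‖v‖ ≤ ‖EuclideanSpace.init v‖ + ‖v (Fin.last d)‖ := by
  rw [EuclideanSpace.norm_eq v, Fin.sum_univ_castSucc]
  refine Real.sqrt_le_iff.2 ⟨by positivity, ?_⟩
  have h : ‖EuclideanSpace.init v‖ ^ 2 = ∑ i : Fin d, ‖v i.castSucc‖ ^ 2 := by
    rw [EuclideanSpace.norm_sq_eq]
    rfl
  rw [← h]
  nlinarith [mul_nonneg (norm_nonneg (EuclideanSpace.init v)) (norm_nonneg (v (Fin.last d)))]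

theorem EuclideanSpace.init_sub_snoc (x : EuclideanSpace ℝ (Fin (d + 1)))
    (u : EuclideanSpace ℝ (Fin d)) (t : ℝ) :
    EuclideanSpace.init (x - EuclideanSpace.snoc u t) = EuclideanSpace.init x - u := by
  ext i
  simp [EuclideanSpace.init, EuclideanSpace.snoc]

theorem EuclideanSpace.init_snoc (u : EuclideanSpace ℝ (Fin d)) (t : ℝ) :
    EuclideanSpace.init (EuclideanSpace.snoc u t) = u := by
  ext i
  simp [EuclideanSpace.init, EuclideanSpace.snoc]

theorem LipschitzWith.snoc_graph {ψ : EuclideanSpace ℝ (Fin d) → ℝ} {K : ℝ≥0}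
    (hψ : LipschitzWith K ψ) : LipschitzWith (1 + K) fun u => EuclideanSpace.snoc u (ψ u) := by
  refine LipschitzWith.of_dist_le_mul fun u w => ?_
  rw [dist_eq_norm]
  refine (EuclideanSpace.norm_le_norm_init_add _).trans ?_
  rw [EuclideanSpace.init_sub_snoc, EuclideanSpace.init_snoc, dist_eq_norm]
  have h := hψ.dist_le_mul u w
  rw [dist_eq_norm, dist_eq_norm] at h
  have e : (EuclideanSpace.snoc u (ψ u) - EuclideanSpace.snoc w (ψ w)) (Fin.last d) =
      ψ u - ψ w := by
    simp [EuclideanSpace.snoc]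
  rw [e]
  push_cast
  linarith

/-- The measures are compared on measurable test sets only, so `s` and `t` may be arbitrary. -/
theorem LipschitzWith.euclideanHausdorffMeasure_restrict_image_le {X Y : Type*}
    [EMetricSpace X] [MeasurableSpace X] [BorelSpace X]
    [EMetricSpace Y] [MeasurableSpace Y] [BorelSpace Y] {f : X → Y} {K : ℝ≥0}
    (hf : LipschitzWith K f) {s : Set X} {t : Set Y} (hst : t ⊆ f '' s) (n : ℕ) :
    (μHE[n] : Measure Y).restrict t ≤ (K ^ n) • Measure.map f ((μHE[n] : Measure X).restrict s) := by
  refine Measure.le_iff.2 fun S hS => ?_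
  have hm : MeasurableSet (f ⁻¹' S) := hf.continuous.measurable hS
  rw [Measure.restrict_apply hS, Measure.smul_apply,
    Measure.map_apply hf.continuous.measurable hS, Measure.restrict_apply hm]
  have hsub : S ∩ t ⊆ f '' (f ⁻¹' S ∩ s) := by
    rintro y ⟨hyS, hyt⟩
    obtain ⟨x, hx, rfl⟩ := hst hyt
    exact ⟨x, ⟨hyS, hx⟩, rfl⟩
  refine (measure_mono hsub).trans ?_
  rw [Measure.euclideanHausdorffMeasure_def, Measure.euclideanHausdorffMeasure_def,
    Measure.smul_apply, Measure.smul_apply, smul_comm]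
  have h := hf.hausdorffMeasure_image_le (d := (n : ℝ)) (Nat.cast_nonneg n) (f ⁻¹' S ∩ s)
  rw [ENNReal.rpow_natCast, ← ENNReal.coe_pow, ← smul_eq_mul] at h
  exact smul_le_smul_of_nonneg_left h zero_le

/-- A subset of a Lipschitz graph is parametrized by `ℝ^d`, up to a constant in its surface
measure, by a continuous map `Y` with `‖x' - u‖ ≤ ‖x - Y u‖` for a projection `x ↦ x'`. -/
theorem IsLipschitzGraph.exists_parametrization {Γ : Set (EuclideanSpace ℝ (Fin (d + 1)))}
    (hΓ : IsLipschitzGraph Γ) :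
    ∃ (Y : EuclideanSpace ℝ (Fin d) → EuclideanSpace ℝ (Fin (d + 1)))
      (A : Set (EuclideanSpace ℝ (Fin d))) (c : ℝ≥0), Continuous Y ∧
      (Bornology.IsBounded Γ → volume A < ⊤) ∧
      (μHE[d] : Measure (EuclideanSpace ℝ (Fin (d + 1)))).restrict Γ ≤
        c • Measure.map Y (volume.restrict A) ∧
      ∀ x, ∃ x', ∀ u, ‖x' - u‖ ≤ ‖x - Y u‖ := by
  obtain ⟨T, A, ψ, K, hψ, rfl⟩ := hΓ
  -- Extending `ψ` to all of `ℝ^d` makes the parametrization globally continuous, whatever the set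
  -- `A`.
  obtain ⟨ψ', hψ', hψψ'⟩ := hψ.extend_real
  set Y : EuclideanSpace ℝ (Fin d) → EuclideanSpace ℝ (Fin (d + 1)) :=
    fun u => T (EuclideanSpace.snoc u (ψ' u)) with hY
  have hYL : LipschitzWith (1 * (1 + K)) Y := T.isometry.lipschitz.comp hψ'.snoc_graph
  have himage : (fun u => T (WithLp.toLp 2 (Fin.snoc (α := fun _ => ℝ) (fun i => u i) (ψ u)))) '' A
      = Y '' A := Set.image_congr fun u hu => by
    simp only [hY, EuclideanSpace.snoc, hψψ' hu]
  rw [himage]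
  have hproj : ∀ x, ∃ x', ∀ u, ‖x' - u‖ ≤ ‖x - Y u‖ := fun x =>
    ⟨EuclideanSpace.init (T.symm x), fun u => by
      rw [← EuclideanSpace.init_sub_snoc _ u (ψ' u)]
      refine (EuclideanSpace.norm_init_le _).trans_eq ?_
      rw [← dist_eq_norm, ← dist_eq_norm, ← T.dist_map, T.apply_symm_apply]⟩
  refine ⟨Y, A, (1 * (1 + K)) ^ d, hYL.continuous, fun hb => ?_, ?_, hproj⟩
  · obtain ⟨x', hx'⟩ := hproj 0
    obtain ⟨R, hR⟩ := hb.exists_norm_le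
    refine (Metric.isBounded_closedBall (x := x') (r := R)).subset (fun u hu => ?_)
      |>.measure_lt_top
    rw [mem_closedBall_iff_norm']
    refine (hx' u).trans ?_
    rw [zero_sub, norm_neg]
    exact hR _ ⟨u, hu, rfl⟩
  · have := hYL.euclideanHausdorffMeasure_restrict_image_le (subset_refl (Y '' A)) d
    rwa [EuclideanSpace.euclideanHausdorffMeasure_eq_volume] at this

/-- Projecting to `ℝ^d` shortens distances, hence increases the weight. The normalization
`2^(k(d+1))` exceeds the one of `ℝ^d` by exactly `2^k`. -/
theorem lintegral_dilatedWeight_sub_graph_le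
    {Y : EuclideanSpace ℝ (Fin d) → EuclideanSpace ℝ (Fin (d + 1))}
    (hY : ∀ x, ∃ x', ∀ u, ‖x' - u‖ ≤ ‖x - Y u‖) {r : ℝ} (hr : 0 ≤ r)
    (A : Set (EuclideanSpace ℝ (Fin d))) (k : ℕ) (x : EuclideanSpace ℝ (Fin (d + 1))) :
    ∫⁻ u in A, dilatedWeight r k (x - Y u) ≤
      (∫⁻ z : EuclideanSpace ℝ (Fin d), decayWeight r z) * ENNReal.ofReal ((2 : ℝ) ^ k) := by
  obtain ⟨x', hx'⟩ := hY x
  refine (setLIntegral_le_lintegral _ _).trans ?_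
  rw [← lintegral_dilatedWeight_sub_left r k x', mul_comm, ← lintegral_const_mul' _ _
    ENNReal.ofReal_ne_top]
  refine lintegral_mono fun u => ?_
  simp only [dilatedWeight, decayWeight, finrank_euclideanSpace, Fintype.card_fin]
  rw [← mul_assoc, ← ENNReal.ofReal_mul (p := 2 ^ k) (by positivity), ← pow_succ']
  gcongr ENNReal.ofReal _ * ENNReal.ofReal ?_
  refine Real.rpow_le_rpow_of_nonpos (by positivity) ?_ (by linarith)
  rw [norm_smul, norm_smul]
  gcongr
  exact hx' u

end Graph

/-- In polar coordinates the radial integrand is `t^(γ - 1)`. -/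
theorem setLIntegral_norm_rpow_lt_top {E : Type*} [NormedAddCommGroup E] [NormedSpace ℝ E]
    [FiniteDimensional ℝ E] [MeasurableSpace E] [BorelSpace E] [Nontrivial E] (μ : Measure E)
    [μ.IsAddHaarMeasure] {γ : ℝ} (hγ : 0 < γ) :
    ∫⁻ h in Metric.closedBall (0 : E) 1, ENNReal.ofReal (‖h‖ ^ (γ - Module.finrank ℝ E)) ∂μ < ⊤ := by
  have hn : 0 < Module.finrank ℝ E := Module.finrank_pos
  have h1 : IntegrableOn (fun h : E => ‖h‖ ^ (γ - Module.finrank ℝ E)) (Metric.ball 0 2) μ := by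
    rw [integrableOn_fun_norm_addHaar μ (f := fun t : ℝ => t ^ (γ - Module.finrank ℝ E))]
    have h2 : IntegrableOn (fun y : ℝ => y ^ (γ - 1)) (Set.Ioo 0 2) :=
      (intervalIntegral.integrableOn_Ioo_rpow_iff two_pos).2 (by linarith)
    refine h2.congr_fun (fun y hy => ?_) measurableSet_Ioo
    simp only [smul_eq_mul]
    rw [← Real.rpow_natCast, ← Real.rpow_add hy.1, Nat.cast_sub hn]
    congr 1
    push_cast
    ring
  refine lt_of_le_of_lt ?_ h1.2
  refine (lintegral_mono_set (Metric.closedBall_subset_ball one_lt_two)).trans ?_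
  refine lintegral_mono fun h => ?_
  rw [Real.enorm_of_nonneg (by positivity)]

/-! ### From the Besov norm to a Hölder-type pointwise estimate -/

section Representation

variable {E : Type*} [NormedAddCommGroup E] [InnerProductSpace ℝ E] [FiniteDimensional ℝ E]
  [MeasurableSpace E] [BorelSpace E]

theorem ae_eq_of_forall_integral_schwartz_mul_eq {p : ℝ} (hp : 1 ≤ p) {g g' : E → ℂ}
    (hg : MemLp g (ENNReal.ofReal p) volume) (hg' : MemLp g' (ENNReal.ofReal p) volume)
    (h : ∀ φ : 𝓢(E, ℂ), ∫ x, φ x * g x = ∫ x, φ x * g' x) : g =ᵐ[volume] g' := by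
  have hp' : 1 ≤ ENNReal.ofReal p := by simpa using hp
  refine ae_eq_of_integral_contDiff_smul_eq (hg.locallyIntegrable hp')
    (hg'.locallyIntegrable hp') fun φ hφ hφc => ?_
  have hc : HasCompactSupport (fun ξ => (φ ξ : ℂ)) :=
    hφc.comp_left (g := fun t : ℝ => (t : ℂ)) (by simp)
  have hs : ContDiff ℝ ∞ (fun ξ => (φ ξ : ℂ)) := Complex.ofRealCLM.contDiff.comp hφ
  simpa [HasCompactSupport.toSchwartzMap_toFun] using h (hc.toSchwartzMap hs)

/-- The infimum is attained, because the functions representing `T` agree almost everywhere. -/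
theorem exists_eLpNorm_le_distLpNorm {p : ℝ} (hp : 1 ≤ p) {T : 𝓢'(E, ℂ)}
    (hT : distLpNorm p T < ⊤) : ∃ g : E → ℂ, MemLp g (ENNReal.ofReal p) volume ∧
      (∀ φ : 𝓢(E, ℂ), T φ = ∫ x, φ x * g x) ∧
      eLpNorm g (ENNReal.ofReal p) volume ≤ distLpNorm p T := by
  have hT' := hT
  rw [distLpNorm] at hT'
  simp only [iInf_lt_iff] at hT'
  obtain ⟨g, hg, hgT, -⟩ := hT'
  refine ⟨g, hg, hgT, le_iInf fun g' => le_iInf fun hg' => le_iInf fun hgT' => ?_⟩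
  exact (eLpNorm_congr_ae (ae_eq_of_forall_integral_schwartz_mul_eq hp hg hg'
    fun φ => by rw [← hgT, hgT'])).le

theorem ofReal_mul_distLpNorm_le_besovNorm (m : LittlewoodPaley E) {s p : ℝ} (hp : 0 < p)
    (f : 𝓢'(E, ℂ)) (k : ℕ) :
    ENNReal.ofReal (((2 : ℝ) ^ k) ^ s) * distLpNorm p (m.proj k f) ≤ besovNorm m s p f := by
  rw [besovNorm, one_div, ENNReal.le_rpow_inv_iff hp, ENNReal.mul_rpow_of_nonneg _ _ hp.le,
    ENNReal.ofReal_rpow_of_nonneg (by positivity) hp.le, ← Real.rpow_mul (by positivity)]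
  exact ENNReal.le_tsum (f := fun k : ℕ =>
    ENNReal.ofReal (((2 : ℝ) ^ k) ^ (s * p)) * distLpNorm p (m.proj k f) ^ p) k

theorem distLpNorm_proj_lt_top (m : LittlewoodPaley E) {s p : ℝ} (hp : 0 < p) {f : 𝓢'(E, ℂ)}
    (hf : besovNorm m s p f < ⊤) (k : ℕ) : distLpNorm p (m.proj k f) < ⊤ := by
  refine lt_of_not_ge fun h => ?_
  have := (ofReal_mul_distLpNorm_le_besovNorm m hp f k).trans_lt hf
  rw [top_le_iff.1 h, ENNReal.mul_top (by simp; positivity)] at this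
  exact lt_irrefl _ this

/-- The sum over all dyadic scales of the averages of `g k`, with weights `2 ^ (k β)`. -/
def smearSum (β : ℝ) (g : ℕ → E → ℂ) (y : E) : ℝ≥0∞ :=
  ∑' k, ENNReal.ofReal (((2 : ℝ) ^ k) ^ β) * smear k (g k) y

theorem measurable_smearSum (β : ℝ) {g : ℕ → E → ℂ}
    (hg : ∀ k, AEStronglyMeasurable (g k) volume) : Measurable (smearSum β g) :=
  Measurable.tsum fun k => (measurable_smear k (hg k)).const_mul _

namespace LittlewoodPaley

theorem tendsto_partialSum_representative (m : LittlewoodPaley E) (f : 𝓢'(E, ℂ)) {y : E}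
    (h : ∑' k, ‖m.projFun k f y‖ₑ < ⊤) :
    Tendsto (fun N => m.partialSum N f y) atTop (𝓝 (m.representative f y)) := by
  have hs : Summable fun k => m.projFun k f y :=
    Summable.of_nnnorm (ENNReal.tsum_coe_ne_top_iff_summable.1 h.ne)
  exact tendsto_nhds_limUnder ⟨_, hs.hasSum.tendsto_sum_nat⟩

theorem enorm_representative_sub_le (m : LittlewoodPaley E) (f : 𝓢'(E, ℂ)) {y z : E}
    (hy : Tendsto (fun N => m.partialSum N f y) atTop (𝓝 (m.representative f y)))
    (hz : Tendsto (fun N => m.partialSum N f z) atTop (𝓝 (m.representative f z))) :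
    ‖m.representative f y - m.representative f z‖ₑ ≤
      ∑' k, ‖m.projFun k f y - m.projFun k f z‖ₑ := by
  refine le_of_tendsto' (hy.sub hz).enorm fun N => ?_
  rw [partialSum, partialSum, ← Finset.sum_sub_distrib]
  exact (enorm_sum_le _ _).trans (ENNReal.sum_le_tsum _)

/-- A function in a Besov space converges, and is Hölder continuous, where the sum of the
averages of its Littlewood-Paley pieces is finite. -/
theorem exists_smearSum_bound (m : LittlewoodPaley E) {s p β : ℝ} (hp : 1 ≤ p) (hβ : 0 ≤ β)
    (hβ1 : β ≤ 1) : ∃ C : ℝ≥0, ∀ f : 𝓢'(E, ℂ), besovNorm m s p f < ⊤ →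
      ∃ g : ℕ → E → ℂ, (∀ k, AEStronglyMeasurable (g k) volume) ∧
        (∀ k, ENNReal.ofReal (((2 : ℝ) ^ k) ^ s) * eLpNorm' (g k) p volume ≤ besovNorm m s p f) ∧
        (∀ y, smearSum β g y < ⊤ →
          Tendsto (fun N => m.partialSum N f y) atTop (𝓝 (m.representative f y))) ∧
        ∀ y z, smearSum β g y < ⊤ → smearSum β g z < ⊤ →
          ‖m.representative f y - m.representative f z‖ₑ ≤
            C * ENNReal.ofReal (‖y - z‖ ^ β) * (smearSum β g y + smearSum β g z) := by
  have hp0 : 0 < p := by linarith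
  obtain ⟨K, hK⟩ := m.exists_kernel
  obtain ⟨C₁, hC₁⟩ := exists_enorm_integral_kernel_le K
  obtain ⟨C₂, hC₂⟩ := exists_enorm_sub_integral_kernel_le K hβ hβ1
  refine ⟨C₂, fun f hf => ?_⟩
  choose g hg hgT hgn using fun k =>
    exists_eLpNorm_le_distLpNorm hp (distLpNorm_proj_lt_top m hp0 hf k)
  have hconv : ∀ y, smearSum β g y < ⊤ →
      Tendsto (fun N => m.partialSum N f y) atTop (𝓝 (m.representative f y)) := fun y hy => by
    refine m.tendsto_partialSum_representative f ?_
    refine lt_of_le_of_lt ?_ (ENNReal.mul_lt_top (ENNReal.coe_lt_top (r := C₁)) hy)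
    rw [smearSum, ← ENNReal.tsum_mul_left]
    refine ENNReal.tsum_le_tsum fun k => ?_
    rw [hK k f (g k) (hgT k)]
    refine (hC₁ k (g k) y).trans ?_
    gcongr
    -- As `β ≥ 0`, the weights are at least 1, so the majorant for increments also dominates the
    -- series itself.
    refine le_mul_of_one_le_left zero_le ?_
    rw [ENNReal.one_le_ofReal]
    exact Real.one_le_rpow (one_le_pow₀ one_le_two) hβ
  refine ⟨g, fun k => (hg k).1, fun k => ?_, hconv, fun y z hy hz => ?_⟩
  · refine le_trans ?_ (ofReal_mul_distLpNorm_le_besovNorm m hp0 f k)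
    gcongr
    have := hgn k
    rwa [eLpNorm_eq_eLpNorm' (by simpa using hp0) ENNReal.ofReal_ne_top,
      ENNReal.toReal_ofReal hp0.le] at this
  · refine (m.enorm_representative_sub_le f (hconv y hy) (hconv z hz)).trans ?_
    rw [smearSum, smearSum, ← ENNReal.tsum_add, ← ENNReal.tsum_mul_left]
    refine ENNReal.tsum_le_tsum fun k => ?_
    rw [hK k f (g k) (hgT k), hK k f (g k) (hgT k)]
    refine (hC₂ k hp (g k) (hg k) y z).trans_eq ?_
    rw [Real.mul_rpow (by positivity) (norm_nonneg _), ENNReal.ofReal_mul (by positivity)]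
    ring

end LittlewoodPaley

/-- Meant for `a = |f(x) - f(y)|` and `b = |x - y|`; on the diagonal the numerator vanishes, so the
quotient is 0. -/
theorem ofReal_rpow_div_rpow_le {a b β q e : ℝ} {c V : ℝ≥0∞} (hq : 0 < q) (ha : 0 ≤ a)
    (hb : 0 ≤ b) (hab : b = 0 → a = 0)
    (h : ENNReal.ofReal a ≤ c * ENNReal.ofReal (b ^ β) * V) :
    ENNReal.ofReal (a ^ q / b ^ e) ≤ c ^ q * (ENNReal.ofReal (b ^ (β * q - e)) * V ^ q) := by
  rcases hb.eq_or_lt with hb | hb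
  · rw [hab hb.symm, Real.zero_rpow hq.ne', zero_div, ENNReal.ofReal_zero]
    exact zero_le
  · have h1 := ENNReal.rpow_le_rpow h hq.le
    rw [ENNReal.mul_rpow_of_nonneg _ _ hq.le, ENNReal.mul_rpow_of_nonneg _ _ hq.le,
      ENNReal.ofReal_rpow_of_nonneg ha hq.le, ENNReal.ofReal_rpow_of_nonneg (by positivity) hq.le,
      ← Real.rpow_mul hb.le] at h1
    rw [div_eq_mul_inv, ENNReal.ofReal_mul (by positivity), Real.rpow_sub hb, div_eq_mul_inv,
      ENNReal.ofReal_mul (by positivity)]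
    refine (mul_le_mul_left h1 _).trans_eq ?_
    ring

theorem setLIntegral_closedBall_eq_translate (F : E → E → ℝ≥0∞) (y : E) (r : ℝ) :
    ∫⁻ x in Metric.closedBall y r, F (x - y) x =
      ∫⁻ h in Metric.closedBall (0 : E) r, F h (y + h) := by
  rw [← (measurePreserving_add_left (volume : Measure E) y).setLIntegral_comp_preimage_emb
    (measurableEmbedding_addLeft y)]
  simp

/-- The inner integral of the trace seminorm, at a point where the majorant is finite. -/
theorem setLIntegral_difference_quotient_le {F : E → ℂ} {V : E → ℝ≥0∞} {C : ℝ≥0}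
    {q α β : ℝ} (hq : 0 < q) (hV : ∀ᵐ x, V x < ⊤)
    (hF : ∀ y z, V y < ⊤ → V z < ⊤ → ‖F y - F z‖ₑ ≤ C * ENNReal.ofReal (‖y - z‖ ^ β) * (V y + V z))
    {y : E} (hy : V y < ⊤) (e : ℝ) :
    ∫⁻ x in Metric.closedBall y 1, ENNReal.ofReal (‖F x - F y‖ ^ q / ‖x - y‖ ^ (e + α * q)) ≤
      (C : ℝ≥0∞) ^ q * ∫⁻ h in Metric.closedBall (0 : E) 1,
        ENNReal.ofReal (‖h‖ ^ ((β - α) * q - e)) * (V (y + h) + V y) ^ q := by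
  rw [← lintegral_const_mul' _ _ (ENNReal.rpow_ne_top_of_nonneg hq.le ENNReal.coe_ne_top),
    ← setLIntegral_closedBall_eq_translate (fun h x => (C : ℝ≥0∞) ^ q *
      (ENNReal.ofReal (‖h‖ ^ ((β - α) * q - e)) * (V x + V y) ^ q))]
  refine lintegral_mono_ae (ae_restrict_of_ae ?_)
  filter_upwards [hV] with x hx
  have h := hF x y hx hy
  rw [← ofReal_norm] at h
  rw [show (β - α) * q - e = β * q - (e + α * q) by ring]
  refine ofReal_rpow_div_rpow_le hq (norm_nonneg _) (norm_nonneg _) (fun h0 => ?_) h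
  rw [norm_eq_zero, sub_eq_zero] at h0
  simp [h0]

end Representation

/-! ### Integration over the graph and its translates -/

section Trace

variable {E : Type*} [NormedAddCommGroup E] [InnerProductSpace ℝ E] [FiniteDimensional ℝ E]
  [MeasurableSpace E] [BorelSpace E]

theorem ae_smearSum_lt_top {Ω : Type*} [MeasurableSpace Ω] {ν : Measure Ω} [SFinite ν]
    {s p β : ℝ} (hp : 1 ≤ p) (hβ : β + 1 / p < s) {A : ℝ≥0∞} (hA : A < ⊤) {Y : Ω → E}
    (hY : Measurable Y)
    (hYA : ∀ k x, ∫⁻ a, dilatedWeight (Module.finrank ℝ E + 1) k (x - Y a) ∂ν ≤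
      A * ENNReal.ofReal ((2 : ℝ) ^ k)) {g : ℕ → E → ℂ} {S : ℝ≥0∞} (hS : S < ⊤)
    (hg : ∀ k, AEStronglyMeasurable (g k) volume)
    (hgS : ∀ k, ENNReal.ofReal (((2 : ℝ) ^ k) ^ s) * eLpNorm' (g k) p volume ≤ S) :
    ∀ᵐ a ∂ν, smearSum β g (Y a) < ⊤ := by
  obtain ⟨C, hC⟩ := exists_eLpNorm'_tsum_smear_le E (ν := ν) hp hβ hA
  exact ae_lt_top_of_eLpNorm'_lt_top ((measurable_smearSum β hg).comp hY) (by linarith)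
    ((hC Y hY hYA g S hg hgS).trans_lt (ENNReal.mul_lt_top ENNReal.coe_lt_top hS))

theorem ae_volume_smearSum_lt_top {s p β : ℝ} (hp : 1 ≤ p) (hβ : β + 1 / p < s) {g : ℕ → E → ℂ}
    {S : ℝ≥0∞} (hS : S < ⊤) (hg : ∀ k, AEStronglyMeasurable (g k) volume)
    (hgS : ∀ k, ENNReal.ofReal (((2 : ℝ) ^ k) ^ s) * eLpNorm' (g k) p volume ≤ S) :
    ∀ᵐ x, smearSum β g x < ⊤ := by
  refine ae_smearSum_lt_top (A := ∫⁻ z : E, decayWeight (Module.finrank ℝ E + 1) z) hp hβ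
    (lintegral_decayWeight_lt_top (by simp)) measurable_id (fun k x => ?_) hS hg hgS
  simp only [id]
  rw [lintegral_dilatedWeight_sub_left]
  -- With `Y` the identity there is no loss; the factor `2 ^ k ≥ 1` is inserted to reuse the graph
  -- lemma.
  refine le_mul_of_one_le_right zero_le ?_
  rw [ENNReal.one_le_ofReal]
  exact one_le_pow₀ one_le_two

/-- The trace estimate for the majorant along a parametrized set all of whose translates satisfy
the same `L^p` bound. -/
theorem lintegral_lintegral_translate_le {Ω : Type*} [MeasurableSpace Ω] {ν : Measure Ω}
    [SFinite ν] {p q : ℝ} (hq : 1 ≤ q) (hqp : q ≤ p) {V : E → ℝ≥0∞} (hV : Measurable V)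
    {Y : Ω → E} (hY : Measurable Y) {M : ℝ≥0∞}
    (hM : ∀ h, eLpNorm' (fun a => V (Y a + h)) p ν ≤ M) {w : E → ℝ≥0∞} (hw : Measurable w)
    (s : Set E) :
    ∫⁻ a, (∫⁻ h in s, w h * (V (Y a + h) + V (Y a)) ^ q) ∂ν ≤
      (∫⁻ h in s, w h) * (2 * M * ν Set.univ ^ (1 / q - 1 / p)) ^ q := by
  have hq0 : 0 < q := by linarith
  have hYh : Measurable fun z : Ω × E => V (Y z.1 + z.2) + V (Y z.1) :=
    (hV.comp ((hY.comp measurable_fst).add measurable_snd)).add (hV.comp (hY.comp measurable_fst))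
  -- Tonelli puts the translation `h` outside, where the bound `M` is uniform.
  rw [lintegral_lintegral_swap
    ((hw.comp measurable_snd).mul (hYh.pow_const q)).aemeasurable,
    ← lintegral_mul_const _ hw]
  refine lintegral_mono fun h => ?_
  have hVh : ∀ h, Measurable fun a => V (Y a + h) := fun h => hV.comp (hY.add_const h)
  have hV0 : Measurable fun a => V (Y a) := hV.comp hY
  have hsum : Measurable fun a => V (Y a + h) + V (Y a) := (hVh h).add hV0
  rw [lintegral_const_mul _ (hsum.pow_const q)]
  gcongr
  have e := lintegral_rpow_enorm_eq_rpow_eLpNorm' (μ := ν)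
    (f := fun a => V (Y a + h) + V (Y a)) hq0
  simp only [enorm_eq_self] at e
  rw [e]
  gcongr
  -- Hölder's inequality from `L^q` to `L^p` produces the power of the total mass.
  refine (eLpNorm'_le_eLpNorm'_mul_rpow_measure_univ hq0 hqp hsum.aestronglyMeasurable).trans ?_
  gcongr
  refine (eLpNorm'_add_le (hVh h).aestronglyMeasurable hV0.aestronglyMeasurable
    (hq.trans hqp)).trans ?_
  rw [two_mul]
  exact add_le_add (hM h) (by simpa using hM 0)

end Trace

end

/-! ### The trace theorem -/

theorem theorem4 {d : ℕ} (m : LittlewoodPaley (EuclideanSpace ℝ (Fin (d + 1))))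
    (Γ : Set (EuclideanSpace ℝ (Fin (d + 1)))) (hΓ : IsLipschitzGraph Γ)
    (s p q α : ℝ) (hq : 1 ≤ q) (hqp : q ≤ p) (hs : 1 / p < s) (hs' : s < 1 + 1 / p)
    (hα : 0 ≤ α) (hα' : α < s - 1 / p) (hbdd : Bornology.IsBounded Γ ∨ q = p) :
    ∃ C : ℝ≥0, ∀ f : 𝓢'(EuclideanSpace ℝ (Fin (d + 1)), ℂ), besovNorm m s p f < ⊤ →
      (∀ᵐ x ∂(volume : Measure (EuclideanSpace ℝ (Fin (d + 1)))),
        Tendsto (fun N => m.partialSum N f x) atTop (𝓝 (m.representative f x))) ∧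
      (∀ᵐ y ∂((μHE[d] : Measure (EuclideanSpace ℝ (Fin (d + 1)))).restrict Γ),
        Tendsto (fun N => m.partialSum N f y) atTop (𝓝 (m.representative f y))) ∧
      (∫⁻ y in Γ, ∫⁻ x in Metric.closedBall y 1,
          ENNReal.ofReal (‖m.representative f x - m.representative f y‖ ^ q /
            ‖x - y‖ ^ ((d + 1 : ℝ) + α * q)) ∂volume
        ∂(μHE[d] : Measure (EuclideanSpace ℝ (Fin (d + 1))))) ^ (1 / q)
        ≤ C * besovNorm m s p f := by

  have hp : 1 ≤ p := hq.trans hqp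
  have hp0 : 0 < p := by linarith
  have hq0 : 0 < q := by linarith
  -- `β > α` makes the singularity in `h` integrable, `β < s - 1/p` makes the dyadic series
  -- converge, and `s < 1 + 1/p` gives `β ≤ 1`.
  obtain ⟨β, hαβ, hβs⟩ := exists_between hα'
  have hβ0 : 0 ≤ β := hα.trans hαβ.le
  obtain ⟨C, hC⟩ := m.exists_smearSum_bound (s := s) hp hβ0 (by linarith)
  obtain ⟨Y, A, c, hYc, hYb, hYΓ, hYp⟩ := hΓ.exists_parametrization
  have hYm : Measurable Y := hYc.measurable
  set ν : Measure (EuclideanSpace ℝ (Fin d)) := volume.restrict A with hν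
  set n : ℝ := ((Module.finrank ℝ (EuclideanSpace ℝ (Fin (d + 1))) : ℕ) : ℝ) with hn
  have hnd : n = d + 1 := by simp [hn]
  set A₀ := ∫⁻ z : EuclideanSpace ℝ (Fin d), decayWeight (n + 1) z with hA₀
  have hA₀t : A₀ < ⊤ := lintegral_decayWeight_lt_top (by rw [hnd]; simp; linarith)
  have hYA : ∀ h k x, ∫⁻ u, dilatedWeight (n + 1) k (x - (Y u + h)) ∂ν ≤
      A₀ * ENNReal.ofReal ((2 : ℝ) ^ k) := fun h k x => by
    have := lintegral_dilatedWeight_sub_graph_le hYp (r := n + 1) (by positivity) A k (x - h)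
    simpa only [sub_sub, add_comm h] using this
  obtain ⟨C', hC'⟩ := exists_eLpNorm'_tsum_smear_le (EuclideanSpace ℝ (Fin (d + 1))) (ν := ν)
    hp (show β + 1 / p < s by linarith) hA₀t
  set W := ∫⁻ h in Metric.closedBall (0 : EuclideanSpace ℝ (Fin (d + 1))) 1,
    ENNReal.ofReal (‖h‖ ^ ((β - α) * q - n)) with hW
  have hWt : W < ⊤ := setLIntegral_norm_rpow_lt_top volume (mul_pos (sub_pos.2 hαβ) hq0)
  set v := ν Set.univ ^ (1 / q - 1 / p) with hv
  have hvt : v < ⊤ := by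
    rcases hbdd with hb | rfl
    · refine ENNReal.rpow_lt_top_of_nonneg ?_ ?_
      · rw [sub_nonneg]
        exact one_div_le_one_div_of_le hq0 hqp
      · rw [hν, Measure.restrict_apply_univ]
        exact (hYb hb).ne
    -- For `q = p` the exponent is 0, so the power is 1 even when the mass is infinite.
    · simp [hv]
  have hCt : ((c : ℝ≥0∞) * W) ^ (1 / q) * (C * (2 * C' * v)) < ⊤ :=
    ENNReal.mul_lt_top (ENNReal.rpow_lt_top_of_nonneg (by positivity)
      (ENNReal.mul_lt_top ENNReal.coe_lt_top hWt).ne)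
      (ENNReal.mul_lt_top ENNReal.coe_lt_top (ENNReal.mul_lt_top
        (ENNReal.mul_lt_top (by simp) ENNReal.coe_lt_top) hvt))
  refine ⟨(((c : ℝ≥0∞) * W) ^ (1 / q) * (C * (2 * C' * v))).toNNReal, fun f hf => ?_⟩
  rw [ENNReal.coe_toNNReal hCt.ne]
  obtain ⟨g, hg, hgS, hconv, hdiff⟩ := hC f hf
  have hVm := measurable_smearSum β hg
  have hae : ∀ᵐ x, smearSum β g x < ⊤ :=
    ae_volume_smearSum_lt_top hp (by linarith) hf hg hgS
  have haeY : ∀ᵐ u ∂ν, smearSum β g (Y u) < ⊤ :=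
    ae_smearSum_lt_top hp (by linarith) hA₀t hYm (fun k x => by simpa only [add_zero] using hYA 0 k x) hf hg hgS
  have haeΓ : ∀ᵐ y ∂((μHE[d] : Measure (EuclideanSpace ℝ (Fin (d + 1)))).restrict Γ),
      smearSum β g y < ⊤ := by
    have h1 : ∀ᵐ y ∂(Measure.map Y ν), smearSum β g y < ⊤ :=
      (ae_map_iff hYm.aemeasurable (measurableSet_lt hVm measurable_const)).2 haeY
    exact ((Measure.absolutelyContinuous_of_le hYΓ).trans
      (Measure.smul_absolutelyContinuous)).ae_le h1
  refine ⟨hae.mono hconv, haeΓ.mono hconv, ?_⟩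
  have hM : ∀ h, eLpNorm' (fun u => smearSum β g (Y u + h)) p ν ≤ C' * besovNorm m s p f :=
    fun h => hC' (fun u => Y u + h) (hYm.add_const h) (hYA h) g _ hg hgS
  rw [← hnd]
  calc _ ≤ ((c : ℝ≥0∞) * ((C : ℝ≥0∞) ^ q *
          (W * (2 * (C' * besovNorm m s p f) * v) ^ q))) ^ (1 / q) := by
        gcongr
        refine (lintegral_mono' hYΓ le_rfl).trans ?_
        rw [lintegral_smul_measure, ENNReal.smul_def, smul_eq_mul]
        gcongr
        -- This direction of the change of variables needs no measurability of the inner integral.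
        refine (lintegral_map_le _ _).trans ?_
        refine (lintegral_mono_ae (haeY.mono fun u hu =>
          setLIntegral_difference_quotient_le hq0 hae hdiff hu n)).trans ?_
        rw [lintegral_const_mul' _ _ (ENNReal.rpow_ne_top_of_nonneg hq0.le ENNReal.coe_ne_top)]
        gcongr
        exact lintegral_lintegral_translate_le hq hqp hVm hYm hM (by fun_prop) _
    _ = _ := by
        have comm : ∀ a b c e : ℝ≥0∞, a * (b * (c * e)) = a * c * (b * e) := by intros; ring
        rw [comm, ← ENNReal.mul_rpow_of_nonneg _ _ hq0.le,
          ENNReal.mul_rpow_of_nonneg _ _ (by positivity), ← ENNReal.rpow_mul,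
          mul_one_div_cancel hq0.ne', ENNReal.rpow_one]
        ring
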